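/- Let $L$ be a complete modular lattice. Write $u\prec v$ when $v$ covers $u$, and for pairs $u\le v$, $z\le w$ write $(u,v)\nearrow(z,w)$ when $v\wedge z=u$ and $v\vee z=w$; projective equivalence $\sim$ of such pairs is the symmetric and transitive closure of $\nearrow$. For a chain $C$ and a covering $x\prec y$, the $C$-multiplicity $\mu_C[x\prec y]$ is the cardinal number of the set of coverings $u\prec v$ with $u,v\in C$ and $(u,v)\sim(x,y)$. A covering is weakly regular if $\mu_C[x\prec y]$ is the same cardinal for all maximal chains $C$; this cardinal is then its multiplicity $\mu[x\prec y]$. A covering $x\prec y$ in $L$ is upper regular if, for every nonempty chain $I$ and all coverings $x_i\prec y_i$ $(i\in I)$ projectively equivalent to $x\prec y$ and such that $(x_i,y_i)\nearrow(x_j,y_j)$ whenever $i<j$, one has $\bigvee_i x_i\prec\bigvee_i y_i$; lower regularity is the dual property (with $\bigwedge_i x_i\prec\bigwedge_i y_i$); regular means upper and lower regular. Let $\operatorname{Fil}L$ be the lattice of filters of $L$ (nonempty up-sets closed under binary meets) ordered by reverse inclusion, and let $\operatorname{Fg}\{x\}=\{z\in L: z\ge x\}$. (1) If $x\prec y$ is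 a lower regular covering in $L$, then $\operatorname{Fg}\{x\}\prec\operatorname{Fg}\{y\}$ in $\operatorname{Fil}L$, and for any maximal chain $C\subseteq L$ and any maximal chain $\bar C\subseteq\operatorname{Fil}L$ containing $\{\operatorname{Fg}\{c\}:c\in C\}$, $$\mu_{\bar C}[\operatorname{Fg}\{x\}\prec\operatorname{Fg}\{y\}]=\mu_C[x\prec y].$$ (2) If $x\prec y$ is a regular covering in $L$, then $x\prec y$ is weakly regular in $L$, $\operatorname{Fg}\{x\}\prec\operatorname{Fg}\{y\}$ is weakly regular in $\operatorname{Fil}L$, and $$\mu[\operatorname{Fg}\{x\}\prec\operatorname{Fg}\{y\}]=\mu[x\prec y].$$ -/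

import Mathlib

namespace RegCov

universe u

section Coverings

variable {L : Type u}

/-- The pair `p = (x, y)` transposes up to the pair `q = (z, w)`: `y ⊓ z = x` and `y ⊔ z = w`.
These equations force `x ≤ y` and `z ≤ w`. -/
def Transposes [Lattice L] (p q : L × L) : Prop :=
  p.2 ⊓ q.1 = p.1 ∧ p.2 ⊔ q.1 = q.2

/-- Projective equivalence of pairs: the equivalence relation generated by `Transposes`. On pairs
`(x, y)` with `x ≤ y` the relation `Transposes` is already reflexive, so there this is just its
symmetric and transitive closure. -/
def ProjEquiv [Lattice L] (p q : L × L) : Prop :=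
  Relation.EqvGen Transposes p q

/-- The multiplicity of `x ⋖ y` in the chain `C`: the cardinal number of coverings `u ⋖ v` with
`u, v ∈ C` that are projectively equivalent to `x ⋖ y`. -/
def chainMult [Lattice L] (C : Set L) (x y : L) : Cardinal.{u} :=
  Cardinal.mk {p : L × L // p.1 ∈ C ∧ p.2 ∈ C ∧ p.1 ⋖ p.2 ∧ ProjEquiv p (x, y)}

/-- The covering `x ⋖ y` is weakly regular, with multiplicity `κ`: its multiplicity in every
maximal chain is `κ`. -/
def HasMultiplicity [Lattice L] (x y : L) (κ : Cardinal.{u}) : Prop :=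
  x ⋖ y ∧ ∀ C : Set L, IsMaxChain (· ≤ ·) C → chainMult C x y = κ

/-- Maximal chains exist, so the multiplicity of a weakly regular covering is unique. -/
theorem HasMultiplicity.unique [Lattice L] {x y : L} {κ ν : Cardinal.{u}}
    (h : HasMultiplicity x y κ) (h' : HasMultiplicity x y ν) : κ = ν :=
  (h.2 _ maxChain_spec).symm.trans (h'.2 _ maxChain_spec)

/-- Upper regularity of a covering `x ⋖ y`: for every nonempty chain of coverings projectively
equivalent to `x ⋖ y`, each transposing up to the later ones, the joins form a covering. -/
def UpperRegular [CompleteLattice L] (x y : L) : Prop :=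
  x ⋖ y ∧ ∀ (I : Type u) [LinearOrder I] [Nonempty I] (a b : I → L),
    (∀ i, a i ⋖ b i) → (∀ i, ProjEquiv (a i, b i) (x, y)) →
    (∀ i j, i < j → Transposes (a i, b i) (a j, b j)) → (⨆ i, a i) ⋖ (⨆ i, b i)

/-- Lower regularity, the dual of upper regularity. -/
def LowerRegular [CompleteLattice L] (x y : L) : Prop :=
  x ⋖ y ∧ ∀ (I : Type u) [LinearOrder I] [Nonempty I] (a b : I → L),
    (∀ i, a i ⋖ b i) → (∀ i, ProjEquiv (a i, b i) (x, y)) →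
    (∀ i j, i < j → Transposes (a i, b i) (a j, b j)) → (⨅ i, a i) ⋖ (⨅ i, b i)

/-- A covering is regular if it is both upper regular and lower regular. -/
def Regular [CompleteLattice L] (x y : L) : Prop :=
  UpperRegular x y ∧ LowerRegular x y

end Coverings

section Filters

/-- The filters of `L` (nonempty, upward closed, closed under finite meets), ordered by reverse
inclusion. -/
abbrev Fil (L : Type u) [Lattice L] : Type u := (Order.PFilter L)ᵒᵈ

variable {L : Type u} [Lattice L]

/-- The intersection of two filters. -/
def interFilter (F G : Order.PFilter L) : Order.PFilter L :=
  Order.IsPFilter.toPFilter (F := {z : L | z ∈ F ∧ z ∈ G}) <| by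
    refine Order.IsPFilter.of_def ?_ ?_ ?_
    · obtain ⟨a, ha⟩ := F.nonempty
      obtain ⟨b, hb⟩ := G.nonempty
      exact ⟨a ⊔ b, Order.PFilter.mem_of_le le_sup_left ha,
        Order.PFilter.mem_of_le le_sup_right hb⟩
    · rintro a ⟨ha, ha'⟩ b ⟨hb, hb'⟩
      exact ⟨a ⊓ b, ⟨Order.PFilter.inf_mem ha hb, Order.PFilter.inf_mem ha' hb'⟩,
        inf_le_left, inf_le_right⟩
    · rintro a b hab ⟨ha, ha'⟩
      exact ⟨Order.PFilter.mem_of_le hab ha, Order.PFilter.mem_of_le hab ha'⟩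

/-- The filter generated by two filters. -/
def genFilter (F G : Order.PFilter L) : Order.PFilter L :=
  Order.IsPFilter.toPFilter (F := {z : L | ∃ a ∈ F, ∃ b ∈ G, a ⊓ b ≤ z}) <| by
    refine Order.IsPFilter.of_def ?_ ?_ ?_
    · obtain ⟨a, ha⟩ := F.nonempty
      obtain ⟨b, hb⟩ := G.nonempty
      exact ⟨a ⊓ b, a, ha, b, hb, le_rfl⟩
    · rintro z ⟨a, ha, b, hb, hz⟩ w ⟨c, hc, d, hd, hw⟩
      refine ⟨z ⊓ w, ⟨a ⊓ c, Order.PFilter.inf_mem ha hc, b ⊓ d, Order.PFilter.inf_mem hb hd, ?_⟩,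
        inf_le_left, inf_le_right⟩
      rw [inf_inf_inf_comm]
      exact inf_le_inf hz hw
    · rintro z w hzw ⟨a, ha, b, hb, hz⟩
      exact ⟨a, ha, b, hb, hz.trans hzw⟩

theorem mem_interFilter {F G : Order.PFilter L} {z : L} :
    z ∈ interFilter F G ↔ z ∈ F ∧ z ∈ G := Iff.rfl

theorem mem_genFilter {F G : Order.PFilter L} {z : L} :
    z ∈ genFilter F G ↔ ∃ a ∈ F, ∃ b ∈ G, a ⊓ b ≤ z := Iff.rfl

/-- The lattice of filters: the join of `F` and `G` is their intersection, and the meet is the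
filter they generate. -/
instance filLattice : Lattice (Fil L) where
  sup F G := OrderDual.toDual (interFilter (OrderDual.ofDual F) (OrderDual.ofDual G))
  inf F G := OrderDual.toDual (genFilter (OrderDual.ofDual F) (OrderDual.ofDual G))
  le_sup_left F G := fun _ hz => (mem_interFilter.1 hz).1
  le_sup_right F G := fun _ hz => (mem_interFilter.1 hz).2
  sup_le F G H hF hG := fun _ hz => mem_interFilter.2 ⟨hF hz, hG hz⟩
  inf_le_left F G := fun z hz => by
    obtain ⟨b, hb⟩ := (OrderDual.ofDual G).nonempty
    exact mem_genFilter.2 ⟨z, hz, b, hb, inf_le_left⟩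
  inf_le_right F G := fun z hz => by
    obtain ⟨a, ha⟩ := (OrderDual.ofDual F).nonempty
    exact mem_genFilter.2 ⟨a, ha, z, hz, inf_le_right⟩
  le_inf F G H hF hG := fun z hz => by
    obtain ⟨a, ha, b, hb, hz⟩ := mem_genFilter.1 hz
    exact Order.PFilter.mem_of_le hz (Order.PFilter.inf_mem (hF ha) (hG hb))

/-- The principal filter `{z | x ≤ z}`, as an element of the lattice of filters. -/
def Fg (x : L) : Fil L := OrderDual.toDual (Order.PFilter.principal x)

end Filters

end RegCov

namespace RegCov

universe u

/-! ### Transposition and coverings in modular lattices -/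

section Modular

variable {L : Type u} [Lattice L]

/-! Part (2) rests on a Jordan–Hölder matching. For `u ⋖ v`, a maximal chain splits according to
whether `v ⊓ c ≤ u`; regularity makes the split occur at a covering `s ⋖ t`, which is projectively
equivalent to `u ⋖ v` and determines it within its own chain. So any two maximal chains have equal
multiplicities.

For part (1), a covering `U ⋖ V` in `D` equivalent to `Fg x ⋖ Fg y` transposes up to some `(Fg a, Fg
b)` with `(a, b)` equivalent to `(x, y)` (`exists_transposes_Fg`). Cutting `C` at `U`, lower
regularity of `a ⋖ b` yields a covering `u ⋖ v` of `C` with `Fg u ≤ U < V ≤ Fg v`, hence equality.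

Applying the matching in `Fil L` requires `Fg x ⋖ Fg y` to be regular there. The lower half holds
because meets of chains of filters are unions. The upper half takes meets of filters to return to
`L`, where upper regularity and Zorn's lemma give an element that keeps the join of the pairs from
collapsing. -/

theorem Transposes.fst_le {p q : L × L} (h : Transposes p q) : p.1 ≤ q.1 :=
  h.1 ▸ inf_le_right

theorem Transposes.snd_le {p q : L × L} (h : Transposes p q) : p.2 ≤ q.2 :=
  h.2 ▸ le_sup_left

theorem Transposes.trans {p q r : L × L} (h : Transposes p q) (h' : Transposes q r) :
    Transposes p r := by
  have hpq := h.snd_le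
  have hqr := h'.fst_le
  obtain ⟨h1, h2⟩ := h
  obtain ⟨h3, h4⟩ := h'
  constructor
  · rw [← h1, ← h3, ← inf_assoc, inf_eq_left.2 hpq]
  · rw [← h4, ← h2, sup_assoc, sup_eq_right.2 hqr]

theorem transposes_inf {a b z : L} (hab : a ⋖ b) (hz : ¬ b ⊓ z ≤ a) :
    Transposes (a ⊓ z, b ⊓ z) (a, b) := by
  constructor
  · change b ⊓ z ⊓ a = a ⊓ z
    rw [inf_right_comm, inf_eq_right.2 hab.le]
  · change b ⊓ z ⊔ a = b
    exact (hab.eq_or_eq le_sup_right (sup_le inf_le_left hab.le)).resolve_left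
      fun h => hz (h ▸ le_sup_left)

theorem transposes_sup {a b z : L} (hab : a ⋖ b) (hz : ¬ b ≤ a ⊔ z) :
    Transposes (a, b) (a ⊔ z, b ⊔ z) := by
  constructor
  · change b ⊓ (a ⊔ z) = a
    exact (hab.eq_or_eq (le_inf hab.le le_sup_left) inf_le_left).resolve_right
      fun h => hz (h ▸ inf_le_right)
  · change b ⊔ (a ⊔ z) = b ⊔ z
    rw [← sup_assoc, sup_eq_left.2 hab.le]

theorem Transposes.projEquiv {p q : L × L} (h : Transposes p q) : ProjEquiv p q :=
  Relation.EqvGen.rel _ _ h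

theorem ProjEquiv.symm {p q : L × L} (h : ProjEquiv p q) : ProjEquiv q p :=
  Relation.EqvGen.symm _ _ h

theorem ProjEquiv.trans {p q r : L × L} (h : ProjEquiv p q) (h' : ProjEquiv q r) :
    ProjEquiv p r :=
  Relation.EqvGen.trans _ _ _ h h'

variable [IsModularLattice L]

theorem Transposes.covBy_iff {p q : L × L} (h : Transposes p q) :
    p.1 ⋖ p.2 ↔ q.1 ⋖ q.2 := by
  obtain ⟨h1, h2⟩ := h
  rw [← h1, ← h2]
  exact ⟨fun h => covBy_sup_of_inf_covBy_left h, fun h => inf_covBy_of_covBy_sup_right h⟩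

theorem ProjEquiv.covBy_iff {p q : L × L} (h : ProjEquiv p q) :
    p.1 ⋖ p.2 ↔ q.1 ⋖ q.2 := by
  induction h with
  | rel _ _ h => exact Transposes.covBy_iff h
  | refl => rfl
  | symm _ _ _ ih => exact ih.symm
  | trans _ _ _ _ _ ih ih' => exact ih.trans ih'

end Modular

/-! ### Cuts of maximal chains -/

section Chains

variable {L : Type u}

theorem _root_.IsMaxChain.mem_of_comparable [LE L] {C : Set L} (hC : IsMaxChain (· ≤ ·) C) {c : L}
    (h : ∀ d ∈ C, c ≤ d ∨ d ≤ c) : c ∈ C := by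
  have := hC.2 (hC.1.insert fun d hd _ => h d hd) (Set.subset_insert c C)
  rw [this]
  exact Set.mem_insert c C

/-- A down-closed property that holds at the join of the elements of a maximal chain having it, and
fails at the meet of the others, changes at a covering of the chain. -/
theorem _root_.IsMaxChain.exists_covBy [CompleteLattice L] {C : Set L}
    (hC : IsMaxChain (· ≤ ·) C) {P : L → Prop} (hP : ∀ c d, c ≤ d → P d → P c)
    (hsup : P (sSup {c ∈ C | P c})) (hinf : ¬ P (sInf {c ∈ C | ¬ P c})) :
    ∃ s ∈ C, ∃ t ∈ C, s ⋖ t ∧ P s ∧ ¬ P t := by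
  have hle : ∀ c ∈ C, P c → ∀ d ∈ C, ¬ P d → c ≤ d := fun c hc hc' d hd hd' =>
    (hC.1.total hc hd).resolve_right fun h => hd' (hP _ _ h hc')
  set s := sSup {c ∈ C | P c} with hs
  set t := sInf {c ∈ C | ¬ P c} with ht
  have hsle : ∀ c ∈ C, P c → c ≤ s := fun c hc hc' => le_sSup ⟨hc, hc'⟩
  have htle : ∀ c ∈ C, ¬ P c → t ≤ c := fun c hc hc' => sInf_le ⟨hc, hc'⟩
  have hst : ∀ c ∈ C, ¬ P c → s ≤ c := fun c hc hc' =>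
    sSup_le fun d hd => hle d hd.1 hd.2 c hc hc'
  have hts : ∀ c ∈ C, P c → c ≤ t := fun c hc hc' =>
    le_sInf fun d hd => hle c hc hc' d hd.1 hd.2
  have hsC : s ∈ C := hC.mem_of_comparable fun d hd => by
    by_cases h : P d
    · exact Or.inr (hsle d hd h)
    · exact Or.inl (hst d hd h)
  have htC : t ∈ C := hC.mem_of_comparable fun d hd => by
    by_cases h : P d
    · exact Or.inr (hts d hd h)
    · exact Or.inl (htle d hd h)
  refine ⟨s, hsC, t, htC, ⟨?_, fun c hsc hct => ?_⟩, hsup, hinf⟩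
  · exact lt_of_le_of_ne (hst t htC hinf) fun h => hinf (h ▸ hsup)
  · have hcC : c ∈ C := hC.mem_of_comparable fun d hd => by
      by_cases h : P d
      · exact Or.inr ((hsle d hd h).trans hsc.le)
      · exact Or.inl (hct.le.trans (htle d hd h))
    by_cases h : P c
    · exact hsc.not_ge (hsle c hcC h)
    · exact hct.not_ge (htle c hcC h)

end Chains

/-! ### Regularity as a closure property of chains -/

section Regularity

variable {L : Type u} [CompleteLattice L]

section Invariance

variable [IsModularLattice L] {x y a b : L}

theorem LowerRegular.of_projEquiv (h : LowerRegular x y) (hab : ProjEquiv (a, b) (x, y)) :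
    LowerRegular a b :=
  ⟨hab.covBy_iff.2 h.1, fun I _ _ f g h1 h2 h3 => h.2 I f g h1 (fun i => (h2 i).trans hab) h3⟩

theorem UpperRegular.of_projEquiv (h : UpperRegular x y) (hab : ProjEquiv (a, b) (x, y)) :
    UpperRegular a b :=
  ⟨hab.covBy_iff.2 h.1, fun I _ _ f g h1 h2 h3 => h.2 I f g h1 (fun i => (h2 i).trans hab) h3⟩

end Invariance

variable [IsModularLattice L] {a b : L}

open Classical in
/-- The elements whose meet with `b` is not below `a` are closed under meets of chains. -/
theorem LowerRegular.not_inf_sInf_le (h : LowerRegular a b) {K : Set L} (hK : IsChain (· ≤ ·) K)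
    (hne : K.Nonempty) (hz : ∀ z ∈ K, ¬ b ⊓ z ≤ a) : ¬ b ⊓ sInf K ≤ a := by
  let := hK.linearOrder
  have := hne.to_subtype
  -- The pairs `(a ⊓ z, b ⊓ z)` have meets `a ⊓ sInf K` and `b ⊓ sInf K`; these would coincide if `b
  -- ⊓ sInf K ≤ a`.
  have key := h.2 K (fun i => a ⊓ i) (fun i => b ⊓ i)
    (fun i => (transposes_inf h.1 (hz i i.2)).covBy_iff.2 h.1)
    (fun i => (transposes_inf h.1 (hz i i.2)).projEquiv)
    (fun i j hij => by
      have hij' : (i : L) ≤ j := hij.le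
      have hj := (transposes_inf h.1 (hz j j.2)).covBy_iff.2 h.1
      have := transposes_inf (z := (i : L)) hj
        (by rw [inf_assoc, inf_eq_right.2 hij']; exact fun h => hz i i.2 (h.trans inf_le_left))
      simpa only [inf_assoc, inf_eq_right.2 hij'] using this)
  rw [← inf_iInf, ← inf_iInf, ← sInf_eq_iInf'] at key
  exact fun hle => key.lt.not_ge (le_inf hle inf_le_right)

open Classical in
/-- The elements whose join with `a` is not above `b` are closed under joins of chains. -/
theorem UpperRegular.not_le_sup_sSup (h : UpperRegular a b) {K : Set L} (hK : IsChain (· ≤ ·) K)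
    (hne : K.Nonempty) (hz : ∀ z ∈ K, ¬ b ≤ a ⊔ z) : ¬ b ≤ a ⊔ sSup K := by
  let := hK.linearOrder
  have := hne.to_subtype
  have key := h.2 K (fun i => a ⊔ i) (fun i => b ⊔ i)
    (fun i => (transposes_sup h.1 (hz i i.2)).covBy_iff.1 h.1)
    (fun i => (transposes_sup h.1 (hz i i.2)).projEquiv.symm)
    (fun i j hij => by
      have hij' : (i : L) ≤ j := hij.le
      have hi := (transposes_sup h.1 (hz i i.2)).covBy_iff.1 h.1
      have := transposes_sup (z := (j : L)) hi
        (by rw [sup_assoc, sup_eq_right.2 hij']; exact fun h => hz j j.2 (le_sup_left.trans h))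
      simpa only [sup_assoc, sup_eq_right.2 hij'] using this)
  rw [← sup_iSup, ← sup_iSup, ← sSup_eq_iSup'] at key
  exact fun hle => key.lt.not_ge (sup_le hle le_sup_right)

end Regularity

/-! ### Jordan–Hölder matching -/

section JordanHolder

variable {L : Type u}

/-- The covering `s ⋖ t` is matched with `u ⋖ v`: the interval `[t ⊓ u, v ⊓ t]` transposes up to
both of them. -/
theorem match_of_covBy [Lattice L] [IsModularLattice L] {u v s t : L} (huv : u ⋖ v) (hst : s ⋖ t)
    (hs : v ⊓ s ≤ u) (ht : ¬ v ⊓ t ≤ u) :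
    t ⊓ u ≤ s ∧ ¬ t ⊓ v ≤ s ∧ ProjEquiv (s, t) (u, v) := by
  have h1 : ¬ t ⊓ v ≤ s := fun h => ht (by
    rw [inf_comm] at h
    exact (le_inf inf_le_left h).trans hs)
  have h2 : t ⊓ u ≤ s := by
    by_contra h
    have e : s ⊔ t ⊓ u = t := (hst.eq_or_eq le_sup_left (sup_le hst.le inf_le_left)).resolve_left
      fun e => h (e ▸ le_sup_right)
    refine ht ?_
    -- Here `t = t ⊓ u ⊔ s`, and the modular law applies because `t ⊓ u ≤ v ⊓ t`.
    calc v ⊓ t = (t ⊓ u ⊔ s) ⊓ (v ⊓ t) := by rw [sup_comm, e, inf_eq_right.2 inf_le_right]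
      _ = t ⊓ u ⊔ s ⊓ (v ⊓ t) :=
        (sup_inf_assoc_of_le _ (le_inf (inf_le_right.trans huv.le) inf_le_left)).symm ▸ rfl
      _ ≤ u := sup_le inf_le_right ((le_inf (inf_le_right.trans inf_le_left) inf_le_left).trans hs)
  refine ⟨h2, h1, ?_⟩
  have e : u ⊓ t = s ⊓ v := le_antisymm
    (le_inf (by rwa [inf_comm]) (inf_le_left.trans huv.le))
    (le_inf (by rwa [inf_comm]) (inf_le_left.trans hst.le))
  have h3 := transposes_inf huv ht
  have h4 := transposes_inf hst h1
  rw [e, inf_comm v t] at h3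
  exact h4.projEquiv.symm.trans h3.projEquiv

/-- A chain crosses out of the down-set of all `c` with `t ⊓ c ≤ s` at most once. -/
theorem eq_of_match [Lattice L] {C : Set L} (hC : IsChain (· ≤ ·) C) {s t u v u' v' : L}
    (hu : u ∈ C) (hv : v ∈ C) (hu' : u' ∈ C) (hv' : v' ∈ C) (h : u ⋖ v) (h' : u' ⋖ v')
    (hs : t ⊓ u ≤ s) (ht : ¬ t ⊓ v ≤ s) (hs' : t ⊓ u' ≤ s) (ht' : ¬ t ⊓ v' ≤ s) :
    u = u' ∧ v = v' := by
  have lt : ∀ {c d}, c ∈ C → d ∈ C → t ⊓ c ≤ s → ¬ t ⊓ d ≤ s → c < d := fun hc hd h1 h2 =>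
    (hC.lt_of_not_ge hd hc fun h => h2 ((inf_le_inf_left t h).trans h1))
  have h1 : u < v' := lt hu hv' hs ht'
  have h2 : u' < v := lt hu' hv hs' ht
  have hu : u = u' := by
    rcases hC.total hu hu' with h3 | h3
    · exact h3.eq_or_lt.resolve_right fun h4 => h.2 h4 h2
    · exact (h3.eq_or_lt.resolve_right fun h4 => h'.2 h4 h1).symm
  subst hu
  refine ⟨rfl, ?_⟩
  rcases hC.total hv hv' with h3 | h3
  · exact h3.eq_or_lt.resolve_right fun h4 => h'.2 h.lt h4
  · exact (h3.eq_or_lt.resolve_right fun h4 => h.2 h'.lt h4).symm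

variable [CompleteLattice L] [IsModularLattice L]

/-- By modularity the cut condition `v ⊓ c ≤ u` is equivalent to `¬ v ≤ u ⊔ c`. The second form lets
upper regularity control the join of the lower part, the first lets lower regularity control the
meet of the upper part. -/
theorem Regular.exists_match {u v : L} (h : Regular u v) {C : Set L}
    (hC : IsMaxChain (· ≤ ·) C) :
    ∃ s ∈ C, ∃ t ∈ C, s ⋖ t ∧ v ⊓ s ≤ u ∧ ¬ v ⊓ t ≤ u := by
  have key : ∀ c, v ⊓ c ≤ u ↔ ¬ v ≤ u ⊔ c := fun c => by
    have e : u ⊔ v ⊓ c = (u ⊔ c) ⊓ v := by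
      rw [sup_inf_assoc_of_le _ h.1.1.le, inf_comm]
    constructor
    · intro h1 h2
      rw [sup_eq_left.2 h1, inf_eq_right.2 h2] at e
      exact h.1.1.lt.ne e
    · intro h1
      by_contra h2
      refine h1 (inf_eq_right.1 (e.symm.trans ?_))
      exact (h.1.1.eq_or_eq le_sup_left (sup_le h.1.1.le inf_le_left)).resolve_left
        fun h3 => h2 (h3 ▸ le_sup_right)
  refine hC.exists_covBy (P := fun c => v ⊓ c ≤ u)
    (fun c d hcd hd => (inf_le_inf_left v hcd).trans hd) ?_ ?_
  · rw [key]
    exact h.1.not_le_sup_sSup (hC.1.mono fun _ hc => hc.1)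
      ⟨⊥, hC.bot_mem, by simp⟩ fun z hz => (key z).1 hz.2
  · exact h.2.not_inf_sInf_le (hC.1.mono fun _ hc => hc.1)
      ⟨⊤, hC.top_mem, by simpa using h.1.1.lt.not_ge⟩ fun z hz => hz.2

theorem Regular.chainMult_le {x y : L} (h : Regular x y) {C D : Set L}
    (hC : IsMaxChain (· ≤ ·) C) (hD : IsMaxChain (· ≤ ·) D) :
    chainMult C x y ≤ chainMult D x y := by
  have key : ∀ p : {p : L × L // p.1 ∈ C ∧ p.2 ∈ C ∧ p.1 ⋖ p.2 ∧ ProjEquiv p (x, y)},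
      ∃ q : {p : L × L // p.1 ∈ D ∧ p.2 ∈ D ∧ p.1 ⋖ p.2 ∧ ProjEquiv p (x, y)},
        q.1.2 ⊓ p.1.1 ≤ q.1.1 ∧ ¬ q.1.2 ⊓ p.1.2 ≤ q.1.1 := by
    rintro ⟨⟨u, v⟩, hu, hv, huv, hp⟩
    obtain ⟨s, hs, t, ht, hst, h1, h2⟩ :=
      Regular.exists_match ⟨h.1.of_projEquiv hp, h.2.of_projEquiv hp⟩ hD
    obtain ⟨h3, h4, h5⟩ := match_of_covBy huv hst h1 h2
    exact ⟨⟨(s, t), hs, ht, hst, h5.trans hp⟩, h3, h4⟩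
  choose f hf using key
  refine Cardinal.mk_le_of_injective (f := f) fun p p' hpp' => ?_
  have h1 := hf p
  have h2 := hf p'
  rw [← hpp'] at h2
  obtain ⟨e, e'⟩ := eq_of_match hC.1 p.2.1 p.2.2.1 p'.2.1 p'.2.2.1 p.2.2.2.1 p'.2.2.2.1
    h1.1 h1.2 h2.1 h2.2
  exact Subtype.ext (Prod.ext e e')

/-- A regular covering of a complete modular lattice is weakly regular. -/
theorem Regular.hasMultiplicity {x y : L} (h : Regular x y) {C : Set L}
    (hC : IsMaxChain (· ≤ ·) C) : HasMultiplicity x y (chainMult C x y) :=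
  ⟨h.1.1, fun _ hD => le_antisymm (h.chainMult_le hD hC) (h.chainMult_le hC hD)⟩

end JordanHolder

/-! ### From chains to filters -/

section Directed

/-- The union of a nonempty chain of filters. -/
def chainUnion {L : Type u} [SemilatticeInf L] (c : Set (Order.PFilter L))
    (hc : IsChain (· ≤ ·) c) (hne : c.Nonempty) : Order.PFilter L :=
  Order.IsPFilter.toPFilter (F := {z : L | ∃ F ∈ c, z ∈ F}) <| by
    refine Order.IsPFilter.of_def ?_ ?_ ?_
    · obtain ⟨F, hF⟩ := hne
      obtain ⟨a, ha⟩ := F.nonempty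
      exact ⟨a, F, hF, ha⟩
    · rintro a ⟨F, hF, ha⟩ b ⟨G, hG, hb⟩
      refine ⟨a ⊓ b, ?_, inf_le_left, inf_le_right⟩
      rcases hc.total hF hG with h | h
      · exact ⟨G, hG, Order.PFilter.inf_mem (h ha) hb⟩
      · exact ⟨F, hF, Order.PFilter.inf_mem ha (h hb)⟩
    · rintro a b hab ⟨F, hF, ha⟩
      exact ⟨F, hF, Order.PFilter.mem_of_le hab ha⟩

variable {L : Type u} [CompleteLattice L]

/-- An upper set closed under meets of nonempty chains contains the meets of the filters that it
contains. -/
theorem sInf_mem_of_chain_closed {S : Set L} (hS : IsUpperSet S)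
    (hchain : ∀ K ⊆ S, IsChain (· ≤ ·) K → K.Nonempty → sInf K ∈ S)
    (F : Order.PFilter L) (hF : (F : Set L) ⊆ S) : sInf (F : Set L) ∈ S := by
  obtain ⟨G, hFG, hG⟩ := zorn_le_nonempty₀ {G : Order.PFilter L | (G : Set L) ⊆ S}
    (fun c hc hcc G hG => ⟨chainUnion c hcc ⟨G, hG⟩,
      fun z ⟨H, hH, hz⟩ => hc hH hz, fun H hH z hz => ⟨H, hH, hz⟩⟩) F hF
  -- Adjoining `sInf K` to `G` stays inside `S`, since `a ⊓ sInf K` is the meet of the chain of all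
  -- `a ⊓ k`; maximality of `G` then applies.
  have hclosed : ∀ K ⊆ (G : Set L), IsChain (· ≤ ·) K → K.Nonempty → sInf K ∈ G := by
    intro K hKG hK hne
    have hsub : (genFilter G (Order.PFilter.principal (sInf K)) : Set L) ⊆ S := by
      rintro z ⟨a, ha, b, hb, hz⟩
      have hmem : sInf ((fun k => a ⊓ k) '' K) ∈ S := by
        refine hchain _ ?_ ?_ (hne.image _)
        · rintro _ ⟨k, hk, rfl⟩
          exact hG.prop (Order.PFilter.inf_mem ha (hKG hk))
        · rintro _ ⟨k, hk, rfl⟩ _ ⟨l, hl, rfl⟩ _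
          exact (hK.total hk hl).imp (inf_le_inf_left a) (inf_le_inf_left a)
      refine hS (le_trans ?_ hz) hmem
      refine le_inf ?_ (le_trans ?_ (Order.PFilter.mem_principal.1 hb))
      · obtain ⟨k, hk⟩ := hne
        exact (sInf_le (Set.mem_image_of_mem _ hk)).trans inf_le_left
      · exact le_sInf fun k hk => (sInf_le (Set.mem_image_of_mem _ hk)).trans inf_le_right
    have hle : G ≤ genFilter G (Order.PFilter.principal (sInf K)) := fun z hz =>
      ⟨z, hz, sInf K, Order.PFilter.mem_principal.2 le_rfl, inf_le_left⟩
    obtain ⟨a, ha⟩ := G.nonempty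
    exact hG.le_of_ge hsub hle
      (mem_genFilter.2 ⟨a, ha, sInf K, Order.PFilter.mem_principal.2 le_rfl, inf_le_right⟩)
  obtain ⟨M, hMmax, hM⟩ : ∃ M, IsMaxChain (· ≤ ·) M ∧
      (∅ : Set (G : Set L)) ⊆ M := IsChain.empty.exists_maxChain
  have hne : ((↑) '' M : Set L).Nonempty := by
    have : Nonempty (G : Set L) := G.nonempty.to_subtype
    exact ((IsMaxChain.nonempty_iff hMmax).1 inferInstance).image _
  have hmG : sInf ((↑) '' M : Set L) ∈ G := by
    refine hclosed _ ?_ ?_ hne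
    · rintro _ ⟨k, _, rfl⟩
      exact k.2
    · rintro _ ⟨k, hk, rfl⟩ _ ⟨l, hl, rfl⟩ _
      exact hMmax.1.total hk hl
  refine hS (le_sInf fun z hz => ?_) (hG.prop hmG)
  -- The meet of `M` is the least element of `G`: its meet with `z` lies in `G` below all of `M`,
  -- hence in `M`.
  have hzm := Order.PFilter.inf_mem (hFG hz) hmG
  have hmem : (⟨_, hzm⟩ : (G : Set L)) ∈ M := hMmax.mem_of_comparable fun d hd =>
    Or.inl (inf_le_right.trans (sInf_le (Set.mem_image_of_mem _ hd)))
  exact (sInf_le (Set.mem_image_of_mem _ hmem)).trans inf_le_left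

/-- Lower regularity for a filter in place of a chain. -/
theorem LowerRegular.exists_mem_inf_le [IsModularLattice L] {a b : L} (h : LowerRegular a b)
    (F : Order.PFilter L) (hF : b ⊓ sInf (F : Set L) ≤ a) : ∃ z ∈ F, b ⊓ z ≤ a := by
  by_contra! hne
  exact sInf_mem_of_chain_closed (S := {z | ¬ b ⊓ z ≤ a})
    (fun z w hzw hz hw => hz ((inf_le_inf_left b hzw).trans hw))
    (fun K hKS hK hKne => h.not_inf_sInf_le hK hKne hKS) F hne hF

end Directed

/-! ### The lattice of filters -/

section Fil

open Order

variable {L : Type u} [Lattice L]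

/-- The elements of the filter `F`. -/
def members (F : Fil L) : PFilter L := OrderDual.ofDual F

theorem members_mono {F G : Fil L} (h : F ≤ G) {z : L} (hz : z ∈ members G) : z ∈ members F :=
  h hz

theorem members_up {F : Fil L} {z w : L} (h : z ≤ w) (hz : z ∈ members F) : w ∈ members F :=
  PFilter.mem_of_le h hz

theorem Fg_le_Fg {a b : L} : Fg a ≤ Fg b ↔ a ≤ b := PFilter.principal_le_principal_iff

theorem le_Fg {F : Fil L} {a : L} : F ≤ Fg a ↔ a ∈ members F := PFilter.principal_le_iff

theorem mem_Fg {a z : L} : z ∈ members (Fg a) ↔ a ≤ z := Iff.rfl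

theorem Fg_injective : Function.Injective (Fg : L → Fil L) := fun _ _ h =>
  le_antisymm (Fg_le_Fg.1 h.le) (Fg_le_Fg.1 h.ge)

theorem Fg_inf (a b : L) : Fg (a ⊓ b) = Fg a ⊓ Fg b :=
  le_antisymm (le_inf (Fg_le_Fg.2 inf_le_left) (Fg_le_Fg.2 inf_le_right)) <|
    le_Fg.2 (mem_genFilter.2 ⟨a, le_rfl, b, le_rfl, le_rfl⟩)

theorem Fg_sup (a b : L) : Fg (a ⊔ b) = Fg a ⊔ Fg b :=
  le_antisymm (fun _ hz => sup_le (mem_interFilter.1 hz).1 (mem_interFilter.1 hz).2)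
    (sup_le (Fg_le_Fg.2 le_sup_left) (Fg_le_Fg.2 le_sup_right))

theorem mem_members_sup {F G : Fil L} {z : L} :
    z ∈ members (F ⊔ G) ↔ z ∈ members F ∧ z ∈ members G := Iff.rfl

theorem mem_members_inf {F G : Fil L} {z : L} :
    z ∈ members (F ⊓ G) ↔ ∃ a ∈ members F, ∃ b ∈ members G, a ⊓ b ≤ z := Iff.rfl

theorem transposes_Fg_iff {a b c d : L} :
    Transposes (Fg a, Fg b) (Fg c, Fg d) ↔ Transposes (a, b) (c, d) := by
  simp only [Transposes, ← Fg_inf, ← Fg_sup, Fg_injective.eq_iff]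

theorem ProjEquiv.map_Fg {p q : L × L} (h : ProjEquiv p q) :
    ProjEquiv (Fg p.1, Fg p.2) (Fg q.1, Fg q.2) := by
  induction h with
  | rel _ _ h => exact (transposes_Fg_iff.2 h).projEquiv
  | refl => exact Relation.EqvGen.refl _
  | symm _ _ _ ih => exact ih.symm
  | trans _ _ _ _ _ ih ih' => exact ih.trans ih'

/-- If `F` lies strictly above `Fg a` and below `Fg b`, it contains `b` but not `a`; so for `z ∈ F`
the element `z ⊓ b` of `[a, b]` must be `b`, and `F` is `Fg b`. -/
theorem Fg_covBy_Fg {a b : L} (h : a ⋖ b) : Fg a ⋖ Fg b := by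
  refine ⟨lt_of_le_not_ge (Fg_le_Fg.2 h.le) fun h' => h.lt.not_ge (Fg_le_Fg.1 h'),
    fun F haF hFb => ?_⟩
  have hb : b ∈ members F := le_Fg.1 hFb.le
  by_cases ha : a ∈ members F
  · exact haF.not_ge (le_Fg.2 ha)
  · refine hFb.not_ge fun z hz => ?_
    have haz : a ≤ z ⊓ b := le_inf (mem_Fg.1 (haF.le hz)) h.le
    rcases h.eq_or_eq haz inf_le_right with e | e
    · exact absurd (e ▸ PFilter.inf_mem hz hb) ha
    · exact inf_eq_right.1 e

instance [IsModularLattice L] : IsModularLattice (Fil L) where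
  sup_inf_le_assoc_of_le {F} G {H} hFH := by
    intro z hz
    obtain ⟨hzF, g, hg, h, hh, hle⟩ := mem_members_sup.1 hz
    -- As `F ≤ H`, `h` lies in `F` too; replacing `z` by `z ⊓ h ≤ h` makes the modular law of `L`
    -- applicable.
    refine mem_members_inf.2 ⟨z ⊓ h ⊔ g, mem_members_sup.2 ⟨members_up le_sup_left
      (PFilter.inf_mem hzF (hFH hh)), members_up le_sup_right hg⟩, h, hh, ?_⟩
    rw [sup_inf_assoc_of_le _ inf_le_right]
    exact sup_le inf_le_left hle

theorem not_mem_of_transposes {U V : Fil L} {a b : L} (hUV : U ⋖ V)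
    (h : Transposes (U, V) (Fg a, Fg b)) : a ∉ members V := fun ha =>
  hUV.lt.ne (h.1.symm.trans (inf_eq_left.2 (le_Fg.2 ha)))

variable [IsModularLattice L]

/-- A covering of filters that is projectively equivalent to a covering of principal filters
transposes up to one. -/
theorem exists_transposes_Fg {x y : L} (hxy : x ⋖ y) {p : Fil L × Fil L}
    (h : ProjEquiv p (Fg x, Fg y)) :
    ∃ a b : L, ProjEquiv (a, b) (x, y) ∧ Transposes p (Fg a, Fg b) := by
  let Q : Fil L × Fil L → Prop := fun p =>
    ∃ a b : L, ProjEquiv (a, b) (x, y) ∧ Transposes p (Fg a, Fg b)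
  have hdown : ∀ p q, Transposes p q → Q q → Q p := fun p q hpq ⟨a, b, hab, hq⟩ =>
    ⟨a, b, hab, hpq.trans hq⟩
  have hup : ∀ p q, Transposes p q → Q p → Q q := by
    rintro ⟨U, V⟩ ⟨U', V'⟩ hpq ⟨a, b, hab, hp⟩
    have hcov : a ⋖ b := hab.covBy_iff.2 hxy
    have hUV : U ⋖ V := hp.covBy_iff.2 (Fg_covBy_Fg hcov)
    have hUV' : U' ⋖ V' := hpq.covBy_iff.1 hUV
    -- An element `t` separating `U'` from `V'` will be the new lower end. Some `v ∈ V` satisfies `a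
    -- ⊓ v ≤ t`, so `a ⋖ b` is first moved down by meeting with `v`, then up by joining with `t`.
    obtain ⟨t, htU', htV'⟩ : ∃ t ∈ members U', t ∉ members V' := by
      by_contra! hcon
      exact hUV'.lt.not_ge hcon
    have hVV' : V ≤ V' := hpq.snd_le
    have htU : t ∈ members (V ⊓ Fg a) := by
      rw [show V ⊓ Fg a = U from hp.1]
      exact members_mono (show U ≤ U' from hpq.fst_le) htU'
    obtain ⟨v, hv, w, hw, hle⟩ := mem_members_inf.1 htU
    have hbV : b ∈ members V := le_Fg.1 hp.snd_le
    have htV : t ∉ members V := fun ht => htV' (by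
      rw [← show V ⊔ U' = V' from hpq.2]
      exact mem_members_sup.2 ⟨ht, htU'⟩)
    have hbv : b ⊓ v ∈ members V := PFilter.inf_mem hbV hv
    have hbva : ¬ b ⊓ v ≤ a := fun h =>
      not_mem_of_transposes hUV hp (members_up h hbv)
    have h1 := transposes_inf hcov hbva
    have h2 : a ⊓ v ≤ t := (le_inf inf_le_right (inf_le_left.trans hw)).trans hle
    have h3 := h1.covBy_iff.2 hcov
    have h4 : Transposes (a ⊓ v, b ⊓ v) (t, b ⊓ v ⊔ t) := by
      refine ⟨?_, rfl⟩
      exact (h3.eq_or_eq (le_inf h3.le h2) inf_le_left).resolve_right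
        fun e => htV (members_up (inf_eq_left.1 e) hbv)
    have h5 : t ⋖ b ⊓ v ⊔ t := h4.covBy_iff.1 h3
    have h6 : b ⊓ v ⊔ t ∈ members V' := by
      rw [← show V ⊔ U' = V' from hpq.2]
      exact mem_members_sup.2 ⟨members_up le_sup_left hbv, members_up le_sup_right htU'⟩
    refine ⟨t, b ⊓ v ⊔ t, h4.projEquiv.symm.trans (h1.projEquiv.trans hab), ?_, ?_⟩
    · exact (hUV'.eq_or_eq (le_inf hUV'.le (le_Fg.2 htU')) inf_le_left).resolve_right
        fun e => htV' (le_Fg.1 (inf_eq_left.1 e))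
    · exact ((Fg_covBy_Fg h5).eq_or_eq le_sup_right
        (sup_le (le_Fg.2 h6) (Fg_le_Fg.2 le_sup_right))).resolve_left
        fun e => htV' (le_Fg.1 (sup_eq_right.1 e))
  have key : ∀ p q : Fil L × Fil L, Relation.EqvGen Transposes p q → (Q p ↔ Q q) := by
    intro p q h
    induction h with
    | rel p q h => exact ⟨hup p q h, hdown p q h⟩
    | refl => rfl
    | symm _ _ _ ih => exact ih.symm
    | trans _ _ _ _ _ ih ih' => exact ih.trans ih'
  exact (key _ _ h).2 ⟨x, y, Relation.EqvGen.refl _, inf_eq_right.2 (Fg_le_Fg.2 hxy.le),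
    sup_eq_left.2 (Fg_le_Fg.2 hxy.le)⟩

end Fil

/-! ### Multiplicity along principal filters -/

section Principal

variable {L : Type u} [CompleteLattice L] [IsModularLattice L] {x y : L}

/-- If `D` contains the principal filters of a maximal chain `C`, its coverings projectively
equivalent to a lower regular covering of principal filters come from coverings of `C`. -/
theorem LowerRegular.exists_eq_Fg (h : LowerRegular x y) {C : Set L} {D : Set (Fil L)}
    (hC : IsMaxChain (· ≤ ·) C) (hD : IsChain (· ≤ ·) D) (hCD : Fg '' C ⊆ D) {U V : Fil L}
    (hU : U ∈ D) (hV : V ∈ D) (hUV : U ⋖ V) (hp : ProjEquiv (U, V) (Fg x, Fg y)) :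
    ∃ u ∈ C, ∃ v ∈ C, u ⋖ v ∧ ProjEquiv (u, v) (x, y) ∧ U = Fg u ∧ V = Fg v := by
  obtain ⟨a, b, hab, ht⟩ := exists_transposes_Fg h.1 hp
  have hreg : LowerRegular a b := h.of_projEquiv hab
  have hV_le : ∀ c ∈ C, ¬ Fg c ≤ U → V ≤ Fg c := fun c hc hcU => by
    have hcD := hCD (Set.mem_image_of_mem _ hc)
    refine (hD.total hV hcD).elim id fun hcV => ?_
    exact ((hUV.eq_or_eq ((hD.total hU hcD).resolve_right hcU) hcV).resolve_left
      fun e => hcU e.le).ge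
  obtain ⟨u, hu, v, hv, huv, hPu, hPv⟩ := hC.exists_covBy (P := fun c => Fg c ≤ U)
    (fun c d hcd hd => (Fg_le_Fg.2 hcd).trans hd)
    -- The join side needs no regularity: every element of `U` is an upper bound of the lower part.
    (fun z hz => sSup_le fun c hc => mem_Fg.1 (members_mono hc.2 hz))
    (fun hle => by
      have hbV : b ∈ members V := le_Fg.1 ht.snd_le
      -- Each `z` in the upper part lies in `V`, so `b ⊓ z ∈ V`, whereas `a ∉ V`. Hence the meet of
      -- the upper part cannot lie below `a`.
      refine hreg.not_inf_sInf_le (K := {c ∈ C | ¬ Fg c ≤ U}) (hC.1.mono fun _ hc => hc.1)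
        ⟨⊤, hC.top_mem, fun htop => ?_⟩ (fun z hz hle' => ?_) (inf_le_right.trans ?_)
      · exact hUV.lt.not_ge ((le_Fg.2 Order.PFilter.top_mem).trans htop)
      · exact not_mem_of_transposes hUV ht
          (members_up hle' (Order.PFilter.inf_mem hbV (le_Fg.1 (hV_le z hz.1 hz.2))))
      · exact Fg_le_Fg.1 (hle.trans ht.fst_le))
  have hle := hV_le v hv hPv
  have hcov := Fg_covBy_Fg huv
  have e : U = Fg u := ((hcov.eq_or_eq hPu (hUV.le.trans hle)).resolve_right
    fun e => hPv e.ge)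
  have e' : V = Fg v := ((hcov.eq_or_eq (hPu.trans hUV.le) hle).resolve_left
    fun e' => hUV.lt.ne (e.trans e'.symm))
  subst e e'
  exact ⟨u, hu, v, hv, huv, (transposes_Fg_iff.1 ht).projEquiv.trans hab, rfl, rfl⟩

theorem LowerRegular.chainMult_Fg (h : LowerRegular x y) {C : Set L} {D : Set (Fil L)}
    (hC : IsMaxChain (· ≤ ·) C) (hD : IsChain (· ≤ ·) D) (hCD : Fg '' C ⊆ D) :
    chainMult D (Fg x) (Fg y) = chainMult C x y := by
  symm
  refine Cardinal.mk_congr (Equiv.ofBijective (fun p => ⟨(Fg p.1.1, Fg p.1.2),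
    hCD (Set.mem_image_of_mem _ p.2.1), hCD (Set.mem_image_of_mem _ p.2.2.1),
    Fg_covBy_Fg p.2.2.2.1, p.2.2.2.2.map_Fg⟩) ⟨fun p q hpq => ?_, ?_⟩)
  · have e := congrArg Subtype.val hpq
    exact Subtype.ext (Prod.ext (Fg_injective (congrArg Prod.fst e))
      (Fg_injective (congrArg Prod.snd e)))
  · rintro ⟨⟨U, V⟩, hU, hV, hUV, hp⟩
    obtain ⟨u, hu, v, hv, huv, huv', rfl, rfl⟩ := h.exists_eq_Fg hC hD hCD hU hV hUV hp
    exact ⟨⟨(u, v), hu, hv, huv, huv'⟩, rfl⟩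

end Principal
-- Regularity in the lattice of filters
section FilComplete

open Order

variable {L : Type u} [CompleteLattice L]

instance : SupSet (Fil L) where
  sSup S := OrderDual.toDual <| IsPFilter.toPFilter (F := {z : L | ∀ F ∈ S, z ∈ members F}) <| by
    refine IsPFilter.of_def ⟨⊤, fun F _ => PFilter.top_mem⟩ ?_ ?_
    · intro a ha b hb
      exact ⟨a ⊓ b, fun F hF => PFilter.inf_mem (ha F hF) (hb F hF), inf_le_left, inf_le_right⟩
    · intro a b hab ha F hF
      exact members_up hab (ha F hF)

theorem isLUB_fil_sSup (S : Set (Fil L)) : IsLUB S (sSup S) :=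
  ⟨fun F hF _ hz => hz F hF, fun _ hG _ hz _ hF => hG hF hz⟩

/-- The lattice of filters of a complete lattice is complete: joins are intersections. -/
instance filCompleteLattice : CompleteLattice (Fil L) :=
  { filLattice, completeLatticeOfSup (Fil L) isLUB_fil_sSup with }

theorem exists_mem_of_mem_iInf {I : Type u} [LinearOrder I] [Nonempty I] {U : I → Fil L}
    (hU : Monotone U) {z : L} (hz : z ∈ members (⨅ i, U i)) : ∃ i, z ∈ members (U i) := by
  have hc : IsChain (· ≤ ·) (Set.range fun i => members (U i)) := by
    rintro _ ⟨i, rfl⟩ _ ⟨j, rfl⟩ _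
    exact (le_total j i).imp (fun h => hU h) fun h => hU h
  have hle : OrderDual.toDual (chainUnion _ hc (Set.range_nonempty _)) ≤ ⨅ i, U i :=
    le_iInf fun i z hz => ⟨_, ⟨i, rfl⟩, hz⟩
  obtain ⟨_, ⟨i, rfl⟩, hi⟩ := hle hz
  exact ⟨i, hi⟩

/-- The meet of all the elements of a filter. -/
def filInf (F : Fil L) : L := sInf {z | z ∈ members F}

theorem filInf_le {F : Fil L} {z : L} (h : z ∈ members F) : filInf F ≤ z := sInf_le h

theorem filInf_mono : Monotone (filInf : Fil L → L) := fun _ _ h =>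
  le_sInf fun _ hz => filInf_le (h hz)

theorem filInf_Fg (a : L) : filInf (Fg a) = a :=
  le_antisymm (filInf_le le_rfl) (le_sInf fun _ hz => hz)

theorem filInf_inf (F G : Fil L) : filInf (F ⊓ G) = filInf F ⊓ filInf G := by
  refine le_antisymm (le_inf (filInf_mono inf_le_left) (filInf_mono inf_le_right)) ?_
  refine le_sInf fun z hz => ?_
  obtain ⟨a, ha, b, hb, h⟩ := mem_members_inf.1 hz
  exact (inf_le_inf (filInf_le ha) (filInf_le hb)).trans h

variable [IsModularLattice L] {x y : L}

/-- No `z ∈ V` has `b ⊓ z ≤ a`, so by lower regularity `filInf V` does not collapse `a ⋖ b` either.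
Meeting `(a, b)` with `filInf V` gives exactly `(filInf U, filInf V)`. -/
theorem LowerRegular.projEquiv_filInf (h : LowerRegular x y) {U V : Fil L}
    (hp : ProjEquiv (U, V) (Fg x, Fg y)) : ProjEquiv (filInf U, filInf V) (x, y) := by
  obtain ⟨a, b, hab, ht⟩ := exists_transposes_Fg h.1 hp
  have hreg := h.of_projEquiv hab
  have hUV : U ⋖ V := hp.covBy_iff.2 (Fg_covBy_Fg h.1)
  have hb : b ∈ members V := le_Fg.1 ht.snd_le
  have hVb : ¬ b ⊓ filInf V ≤ a := fun hle => by
    obtain ⟨z, hz, hza⟩ := hreg.exists_mem_inf_le (members V) hle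
    exact not_mem_of_transposes hUV ht (members_up hza (PFilter.inf_mem hb hz))
  have key := transposes_inf hreg.1 hVb
  have e : filInf U = a ⊓ filInf V := by
    rw [← show V ⊓ Fg a = U from ht.1, filInf_inf, filInf_Fg, inf_comm]
  rw [inf_eq_right.2 (filInf_le hb), ← e] at key
  exact key.projEquiv.trans hab

theorem monotone_of_transposes {M : Type u} [Lattice M] {I : Type u} [LinearOrder I] {f g : I → M}
    (h : ∀ i j, i < j → Transposes (f i, g i) (f j, g j)) : Monotone f ∧ Monotone g :=
  ⟨fun i j hij => hij.eq_or_lt.elim (fun e => e ▸ le_rfl) fun e => (h i j e).fst_le,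
    fun i j hij => hij.eq_or_lt.elim (fun e => e ▸ le_rfl) fun e => (h i j e).snd_le⟩

/-- An element `a` of `U i₀` outside `V i₀` lies in no `V i`, hence not in their union `⨅ i, V i`.
So the pair of meets does not collapse, and it transposes up to `(U i₀, V i₀)`. -/
theorem LowerRegular.lowerRegular_Fg (h : LowerRegular x y) : LowerRegular (Fg x) (Fg y) := by
  refine ⟨Fg_covBy_Fg h.1, fun I _ _ U V hcov hproj htr => ?_⟩
  obtain ⟨hU, hV⟩ := monotone_of_transposes htr
  obtain ⟨i₀⟩ := ‹Nonempty I›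
  obtain ⟨a, b, -, ht⟩ := exists_transposes_Fg h.1 (hproj i₀)
  have ha := not_mem_of_transposes (hcov i₀) ht
  have haU : U i₀ ≤ Fg a := ht.fst_le
  have hnot : ¬ ⨅ i, V i ≤ U i₀ := fun hle => by
    have : Nonempty I := ⟨i₀⟩
    obtain ⟨i, hi⟩ := exists_mem_of_mem_iInf hV (le_Fg.1 (hle.trans haU))
    rcases le_or_gt i₀ i with hij | hij
    · exact ha (members_mono (hV hij) hi)
    · refine ha (le_Fg.1 ?_)
      rw [← show V i ⊔ U i₀ = V i₀ from (htr i i₀ hij).2]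
      exact sup_le (le_Fg.2 hi) haU
  have key : Transposes (⨅ i, U i, ⨅ i, V i) (U i₀, V i₀) := by
    constructor
    · refine le_antisymm (le_iInf fun i => ?_)
        (le_inf (iInf_mono fun i => (hcov i).le) (iInf_le _ _))
      rcases le_or_gt i₀ i with hij | hij
      · exact inf_le_right.trans (hU hij)
      · rw [← show V i ⊓ U i₀ = U i from (htr i i₀ hij).1]
        exact inf_le_inf_right _ (iInf_le _ _)
    · exact ((hcov i₀).eq_or_eq le_sup_right (sup_le (iInf_le _ _) (hcov i₀).le)).resolve_left
        fun e => hnot (sup_eq_right.1 e)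
  exact key.covBy_iff.2 (hcov i₀)

/-- Below a regular covering `s ⋖ t`, an element whose join with `s` is not above `t` extends to
one that is maximal with this property. -/
theorem UpperRegular.exists_maximal {s t w : L} (h : UpperRegular s t) (hw : ¬ t ≤ s ⊔ w) :
    ∃ m, s ⊔ w ≤ m ∧ Maximal (fun m => s ≤ m ∧ ¬ t ≤ m) m :=
  zorn_le_nonempty₀ {m | s ≤ m ∧ ¬ t ≤ m}
    (fun c hc hcc m hm => by
      have hs : s ≤ sSup c := (hc hm).1.trans (le_sSup hm)
      refine ⟨sSup c, ⟨hs, ?_⟩, fun z hz => le_sSup hz⟩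
      have := h.not_le_sup_sSup hcc ⟨m, hm⟩ fun z hz => by
        rw [sup_eq_right.2 (hc hz).1]
        exact (hc hz).2
      rwa [sup_eq_right.2 hs] at this) _ ⟨le_sup_left, hw⟩

/-- A maximal element separating a regular covering `s ⋖ t` belongs to every filter whose meet lies
below it. -/
theorem mem_of_maximal {s t m : L} (h : LowerRegular s t)
    (hm : Maximal (fun m => s ≤ m ∧ ¬ t ≤ m) m) {F : Fil L} (hF : filInf F ≤ m) :
    m ∈ members F := by
  have hsm : s ⊔ m = m := sup_eq_right.2 hm.prop.1
  have htr := transposes_sup (z := m) h.1 (by rw [hsm]; exact hm.prop.2)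
  rw [hsm] at htr
  obtain ⟨z, hz, hle⟩ := (h.of_projEquiv htr.projEquiv.symm).exists_mem_inf_le (members F)
    (inf_le_right.trans hF)
  refine members_up ?_ hz
  -- By modularity `m ⊔ z` is still not above `t`, so maximality of `m` forces `z ≤ m`.
  refine le_sup_right.trans (hm.le_of_ge (y := m ⊔ z)
    ⟨hm.prop.1.trans le_sup_left, fun ht => hm.prop.2 ?_⟩ le_sup_left)
  calc t ≤ (m ⊔ z) ⊓ (t ⊔ m) := le_inf ht le_sup_left
    _ = m ⊔ z ⊓ (t ⊔ m) := sup_inf_assoc_of_le _ le_sup_right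
    _ ≤ m := sup_le le_rfl (by rwa [inf_comm])

/-- Joins of filters are intersections, so an element common to all `U i` but outside `V i₀` is
needed. A maximal `m` above `s` and all `filInf (U i)` but not above `t` serves: `mem_of_maximal`
puts it in every `U i`, and `t = filInf (V i₀)` keeps it out of `V i₀`. -/
theorem Regular.upperRegular_Fg (h : Regular x y) : UpperRegular (Fg x) (Fg y) := by
  refine ⟨Fg_covBy_Fg h.1.1, fun I _ _ U V hcov hproj htr => ?_⟩
  obtain ⟨hU, hV⟩ := monotone_of_transposes htr
  obtain ⟨i₀⟩ := ‹Nonempty I›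
  have hst := h.2.projEquiv_filInf (hproj i₀)
  set s := filInf (U i₀) with hs
  set t := filInf (V i₀) with ht
  have hupper : UpperRegular s t := h.1.of_projEquiv hst
  have hlower : LowerRegular s t := h.2.of_projEquiv hst
  have hw : ¬ t ≤ s ⊔ sSup (Set.range fun i => filInf (U i)) := by
    refine hupper.not_le_sup_sSup ?_ ⟨_, i₀, rfl⟩ ?_
    · rintro _ ⟨i, rfl⟩ _ ⟨j, rfl⟩ _
      exact (le_total i j).imp (fun h => filInf_mono (hU h)) fun h => filInf_mono (hU h)
    · rintro _ ⟨i, rfl⟩ hle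
      refine hlower.1.lt.not_ge ?_
      rcases le_or_gt i i₀ with hij | hij
      · rwa [sup_eq_left.2 (filInf_mono (hU hij))] at hle
      · rw [sup_eq_right.2 (filInf_mono (hU hij.le))] at hle
        rw [hs, ← show V i₀ ⊓ U i = U i₀ from (htr i₀ i hij).1, filInf_inf]
        exact le_inf le_rfl hle
  obtain ⟨m, hwm, hm⟩ := hupper.exists_maximal hw
  have hmU : ⨆ i, U i ≤ Fg m := iSup_le fun i => le_Fg.2 <| mem_of_maximal hlower hm <|
    (le_sSup (Set.mem_range_self i)).trans (le_sup_right.trans hwm)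
  have hnot : ¬ V i₀ ≤ ⨆ i, U i := fun hle => hm.prop.2 (filInf_le (le_Fg.1 (hle.trans hmU)))
  have key : Transposes (U i₀, V i₀) (⨆ i, U i, ⨆ i, V i) := by
    constructor
    · exact ((hcov i₀).eq_or_eq (le_inf (hcov i₀).le (le_iSup _ _)) inf_le_left).resolve_right
        fun e => hnot (inf_eq_left.1 e)
    · change V i₀ ⊔ (⨆ i, U i) = ⨆ i, V i
      refine le_antisymm (sup_le (le_iSup _ _) (iSup_mono fun i => (hcov i).le))
        (iSup_le fun i => ?_)
      rcases le_or_gt i i₀ with hij | hij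
      · exact (hV hij).trans le_sup_left
      · rw [← show V i₀ ⊔ U i = V i from (htr i₀ i hij).2]
        exact sup_le_sup_left (le_iSup _ _) _
  exact key.covBy_iff.1 (hcov i₀)

end FilComplete

end RegCov

theorem mainTheorem6 {L : Type*} [CompleteLattice L] [IsModularLattice L] (x y : L) :
    (RegCov.LowerRegular x y →
      RegCov.Fg x ⋖ RegCov.Fg y ∧
      ∀ (C : Set L) (D : Set (RegCov.Fil L)), IsMaxChain (· ≤ ·) C → IsMaxChain (· ≤ ·) D →
        RegCov.Fg '' C ⊆ D →
        RegCov.chainMult D (RegCov.Fg x) (RegCov.Fg y) = RegCov.chainMult C x y) ∧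
    (RegCov.Regular x y →
      ∃ κ : Cardinal, RegCov.HasMultiplicity x y κ ∧
        RegCov.HasMultiplicity (RegCov.Fg x) (RegCov.Fg y) κ) := by
  refine ⟨fun h => ⟨RegCov.Fg_covBy_Fg h.1, fun C D hC hD => h.chainMult_Fg hC hD.1⟩,
    fun h => ?_⟩
  obtain ⟨C, hC, -⟩ := (IsChain.empty (r := ((· ≤ ·) : L → L → Prop))).exists_maxChain
  have hchain : IsChain (· ≤ ·) (RegCov.Fg '' C) := by
    rintro _ ⟨a, ha, rfl⟩ _ ⟨b, hb, rfl⟩ _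
    exact (hC.1.total ha hb).imp RegCov.Fg_le_Fg.2 RegCov.Fg_le_Fg.2
  obtain ⟨D, hD, hCD⟩ := hchain.exists_maxChain
  refine ⟨RegCov.chainMult C x y, h.hasMultiplicity hC, ?_⟩
  rw [← h.2.chainMult_Fg hC hD.1 hCD]
  exact RegCov.Regular.hasMultiplicity ⟨h.upperRegular_Fg, h.2.lowerRegular_Fg⟩ hD
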